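/- Let $G_{\mathrm{bip}}(n,p)$ be the random bipartite graph with disjoint sides $L,R$, $|L|=|R|=n$, in which each edge of $L\times R$ is present independently with probability $p$. An independent set $I$ is $\gamma$-balanced if $\bigl||I\cap L|-\gamma|I|\bigr|<1$ or $\bigl||I\cap R|-\gamma|I|\bigr|<1$. Put $b=1/(1-p)$, $\alpha_{\rm STAT}=\frac{\log_b n}{\gamma(1-\gamma)}$ and $\alpha_{\rm COMP}=(1-\gamma)\alpha_{\rm STAT}=\frac{\log_b n}{\gamma}$. A (randomized) online algorithm $\mathcal A$ has an internal random seed $\omega$, drawn from an arbitrary probability space independently of the graph $G$, and runs for $2n$ rounds. In round $t$, based on $\omega$ and all information revealed so far, it selects a vertex $v_t\in L\cup R$ not selected before, and the status of all pairs $(v_t,v_s)$, $s<t$, is revealed; then, based on $\omega$ and all information revealed so far, it irrevocably decides whether $v_t$ joins its output. Its selection and decision rules are measurable in $\omega$ but otherwise arbitrary (adaptive arrival order, unbounded running time). Let $\mathcal A(G)$ be the set of vertices that have joined after $2n$ rounds. Theorem. For every $p\in(0,1)$ there is a constant $c=c(p)>0$ such that for every $\gamma\in(0,\tfrac12]$ and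 every $\epsilon>0$ there is $N$ such that for all $n\ge N$ the following holds: for no online algorithm $\mathcal A$ is it true that, when $G\sim G_{\mathrm{bip}}(n,p)$, $$\mathbb P\bigl[\mathcal A(G)\text{ is a }\gamma\text{-balanced independent set of }G\text{ and }|\mathcal A(G)|\ge(1+\epsilon)\alpha_{\rm COMP}\bigr]\ \ge\ \exp\bigl(-c\,\epsilon^2\log_b^2 n\bigr),$$ the probability being over both $G$ and $\omega$. -/

import Mathlib

open MeasureTheory

noncomputable section

/-- The vertex set of a bipartite graph whose two sides `L` and `R` have `n` vertices each:
the left summand is `L` and the right summand is `R`. -/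
abbrev BipVertex (n : ℕ) : Type := Fin n ⊕ Fin n

/-- The status (present or absent) of every potential edge in `L × R`. -/
abbrev EdgeVector (n : ℕ) : Type := Fin n × Fin n → Bool

/-- The bipartite graph on `L ∪ R` with the prescribed edges between `L` and `R`. -/
def bipGraph {n : ℕ} (E : EdgeVector n) : SimpleGraph (BipVertex n) where
  Adj
    | Sum.inl i, Sum.inr j => E (i, j) = true
    | Sum.inr j, Sum.inl i => E (i, j) = true
    | _, _ => False
  symm := ⟨by rintro (i | i) (j | j) h <;> exact h⟩
  loopless := ⟨by rintro (i | i) h <;> exact h⟩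

/-- The law of the random bipartite graph `G_bip(n, p)`: each edge of `L × R` is present
independently with probability `p`. -/
def bipRandom (n : ℕ) (p : unitInterval) : Measure (EdgeVector n) :=
  Measure.pi fun _ => ProbabilityTheory.bernoulliMeasure true false p

/-- `I` is a `γ`-balanced independent set of the bipartite graph `G`. -/
def IsBalancedIndepSet {n : ℕ} (G : SimpleGraph (BipVertex n)) (γ : ℝ)
    (I : Finset (BipVertex n)) : Prop :=
  G.IsIndepSet (I : Set (BipVertex n)) ∧
    (|(I.toLeft.card : ℝ) - γ * (I.card : ℝ)| < 1 ∨
      |(I.toRight.card : ℝ) - γ * (I.card : ℝ)| < 1)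

/-- What has been revealed after some number of rounds, most recent round first: the entry of
round `t` is the vertex `v_t` together with the set of its neighbours among the vertices
`v_1, …, v_{t-1}` seen before. -/
abbrev Transcript (n : ℕ) : Type := List (BipVertex n × Finset (BipVertex n))

/-- The set of vertices that have already been selected. -/
def Transcript.seen {n : ℕ} (h : Transcript n) : Finset (BipVertex n) :=
  (h.map Prod.fst).toFinset

/-- A randomized online algorithm whose internal randomness is a seed in `Ω`.
Both rules may depend in an arbitrary (measurable) way on the seed and on everything revealed so
far; the algorithm's own earlier decisions are functions of these data. No bound on the running
time is imposed. -/
structure OnlineAlgorithm (Ω : Type*) [MeasurableSpace Ω] (n : ℕ) where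
  /-- The vertex selected next, given the seed and the information revealed so far. -/
  next : Ω → Transcript n → BipVertex n
  /-- Whether the vertex just selected joins the output, given the seed and the information
  revealed so far, including the edges from that vertex to the vertices seen before. -/
  accept : Ω → Transcript n → Bool
  /-- As long as some vertex has not been seen, the selected vertex is a new one. -/
  next_notMem : ∀ ω h, h.seen ≠ Finset.univ → next ω h ∉ h.seen
  measurableSet_next : ∀ h v, MeasurableSet {ω | next ω h = v}
  measurableSet_accept : ∀ h, MeasurableSet {ω | accept ω h = true}

namespace OnlineAlgorithm

variable {Ω : Type*} [MeasurableSpace Ω] {n : ℕ}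

open scoped Classical in
/-- The information revealed in the first `t` rounds on the graph `G` with seed `ω`. -/
def transcript (A : OnlineAlgorithm Ω n) (G : SimpleGraph (BipVertex n)) (ω : Ω) :
    ℕ → Transcript n
  | 0 => []
  | t + 1 =>
    let h := A.transcript G ω t
    let v := A.next ω h
    (v, h.seen.filter fun u => G.Adj v u) :: h

/-- The set constructed in the first `t` rounds: decisions are made immediately and are
irrevocable. -/
def partialOutput (A : OnlineAlgorithm Ω n) (G : SimpleGraph (BipVertex n)) (ω : Ω) :
    ℕ → Finset (BipVertex n)
  | 0 => ∅
  | t + 1 =>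
    if A.accept ω (A.transcript G ω (t + 1)) = true then
      insert (A.next ω (A.transcript G ω t)) (A.partialOutput G ω t)
    else A.partialOutput G ω t

/-- The output of the algorithm after all `2n` rounds. -/
def output (A : OnlineAlgorithm Ω n) (G : SimpleGraph (BipVertex n)) (ω : Ω) :
    Finset (BipVertex n) :=
  A.partialOutput G ω (2 * n)

/-- The algorithm `(k, δ)`-optimizes the `γ`-balanced independent set problem in `G_bip(n, p)`:
with probability at least `δ` over the seed, of law `μ`, and the independent random graph, its
output is a `γ`-balanced independent set of size at least `k`. -/
def Optimizes (A : OnlineAlgorithm Ω n) (μ : Measure Ω) (p : unitInterval) (γ k δ : ℝ) : Prop :=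
  ENNReal.ofReal δ ≤ (μ.prod (bipRandom n p))
    {x | IsBalancedIndepSet (bipGraph x.2) γ (A.output (bipGraph x.2) x.1) ∧
      k ≤ ((A.output (bipGraph x.2) x.1).card : ℝ)}

end OnlineAlgorithm

/-- The base `b = 1 / (1 - p)` of the logarithms. -/
def logBase (p : unitInterval) : ℝ := 1 / (1 - (p : ℝ))

/-- The statistical threshold `log_b n / (γ (1 - γ))`. -/
def alphaStat (p : unitInterval) (γ : ℝ) (n : ℕ) : ℝ :=
  Real.logb (logBase p) n / (γ * (1 - γ))

/-- The computational threshold `(1 - γ) α_STAT = log_b n / γ`. -/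
def alphaComp (p : unitInterval) (γ : ℝ) (n : ℕ) : ℝ := (1 - γ) * alphaStat p γ n

end

noncomputable section

/-! ### The product measure on edge vectors -/

/-! Write `q = 1 - p = exp (-β)` and `ℓ = log_b n`. Since `γ ≤ 1/2`, a successful output has more
than `(1 + ε) ℓ - 1` vertices on each side. To push both sides past `r ≈ (1 + ε/2) ℓ`, the algorithm
needs about `εℓ/2` rounds in which the new vertex faces at least `r` chosen vertices and is adjacent
to none (`min_card_le`). The pairs at a new vertex are still unrevealed, so given the past each
round is of this kind with probability at most `q ^ r`, whatever the algorithm does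
(`bipRandom_transcript_inter_le`). Hence the number `F` of such rounds satisfies `E[x ^ F] ≤ (1 + x
q ^ r) ^ (2n)` (`lintegral_pow_freeCount_le`). With `x = b ^ (εℓ/2)` this is at most `e ^ 2`, and
Markov's inequality gives a tail of order `exp (-βε²ℓ²/4)` up to lower-order terms. The bound is
uniform in the seed, so it survives averaging over it. -/

instance {n : ℕ} (p : unitInterval) : IsProbabilityMeasure (bipRandom n p) := by
  unfold bipRandom; infer_instance

theorem bipRandom_forall_false {n : ℕ} (p : unitInterval) (T : Finset (Fin n × Fin n)) :
    bipRandom n p {E | ∀ e ∈ T, E e = false} = ENNReal.ofReal (1 - p) ^ T.card := by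
  classical
  have hset : {E : EdgeVector n | ∀ e ∈ T, E e = false} =
      Set.pi Set.univ (fun e => if e ∈ T then {false} else Set.univ) := by
    ext E
    simp only [Set.mem_ofPred_eq, Set.mem_pi, Set.mem_univ, true_implies]
    refine forall_congr' fun e => ?_
    split_ifs with h <;> simp [h]
  have hfalse : ProbabilityTheory.bernoulliMeasure true false p {false} =
      ENNReal.ofReal (1 - p) := by
    rw [ProbabilityTheory.bernoulliMeasure_apply_of_notMem_of_mem p (by simp) (by simp)
      (by simp)]
    rw [← ENNReal.ofReal_coe_nnreal]
    simp
  rw [hset, bipRandom, Measure.pi_pi]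
  have : ∀ e : Fin n × Fin n, ProbabilityTheory.bernoulliMeasure true false p
      (if e ∈ T then {false} else Set.univ) = if e ∈ T then ENNReal.ofReal (1 - p) else 1 := by
    intro e
    split_ifs
    · exact hfalse
    · simp
  rw [Finset.prod_congr rfl fun e _ => this e]
  simp

/-- An event not depending on the edges in `T` is independent of the event that no edge of `T`
is present. -/
theorem bipRandom_inter_forall_false {n : ℕ} (p : unitInterval) (T : Finset (Fin n × Fin n))
    (S : Set (EdgeVector n))
    (hS : ∀ E E' : EdgeVector n, (∀ e ∉ T, E e = E' e) → E ∈ S → E' ∈ S) :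
    bipRandom n p (S ∩ {E | ∀ e ∈ T, E e = false}) =
      ENNReal.ofReal (1 - p) ^ T.card * bipRandom n p S := by
  classical
  rw [← bipRandom_forall_false, mul_comm]
  have hind : ProbabilityTheory.iIndepFun (fun (e : Fin n × Fin n) (E : EdgeVector n) => E e)
      (bipRandom n p) :=
    ProbabilityTheory.iIndepFun_pi (X := fun _ => id) (fun _ => aemeasurable_id)
  have h := hind.indepFun_finset Tᶜ T disjoint_compl_left (fun e => measurable_pi_apply e)
  -- By `hS`, `S` is the preimage of its own image under restriction to `Tᶜ`.
  have h2 := h.measure_inter_preimage_eq_mul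
    ((fun (E : EdgeVector n) (i : (Tᶜ : Finset _)) => E i) '' S)
    {f | ∀ e, f e = false} (Set.toFinite _).measurableSet (Set.toFinite _).measurableSet
  convert h2 using 3
  · apply Set.Subset.antisymm (Set.subset_preimage_image _ _)
    rintro E ⟨E', hE', heq⟩
    refine hS E' E (fun e he => ?_) hE'
    exact congrFun heq ⟨e, by simpa using he⟩
  · ext E; simp
  · apply Set.Subset.antisymm (Set.subset_preimage_image _ _)
    rintro E ⟨E', hE', heq⟩
    refine hS E' E (fun e he => ?_) hE'
    exact congrFun heq ⟨e, by simpa using he⟩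
  · ext E; simp

/-! ### The potential edges between a vertex and a set -/

/-- The potential edges between `v` and the vertices of `I` on the other side. -/
def edgesTo {n : ℕ} (v : BipVertex n) (I : Finset (BipVertex n)) : Finset (Fin n × Fin n) :=
  match v with
  | Sum.inl i => I.toRight.image fun j => (i, j)
  | Sum.inr j => I.toLeft.image fun i => (i, j)

theorem card_edgesTo_inl {n : ℕ} (i : Fin n) (I : Finset (BipVertex n)) :
    (edgesTo (Sum.inl i) I).card = I.toRight.card :=
  Finset.card_image_of_injective _ (Prod.mk_right_injective i)

theorem card_edgesTo_inr {n : ℕ} (j : Fin n) (I : Finset (BipVertex n)) :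
    (edgesTo (Sum.inr j) I).card = I.toLeft.card :=
  Finset.card_image_of_injective _ (Prod.mk_left_injective j)

theorem forall_edgesTo_eq_false_iff {n : ℕ} (E : EdgeVector n) (v : BipVertex n)
    (I : Finset (BipVertex n)) :
    (∀ e ∈ edgesTo v I, E e = false) ↔ ∀ u ∈ I, ¬ (bipGraph E).Adj v u := by
  rcases v with i | j
  · simp [edgesTo, bipGraph]
  · simp [edgesTo, bipGraph]

/-- Changing edges between `v` and other vertices does not affect adjacency among vertices
different from `v`. -/
theorem adj_iff_of_eqOn_compl_edgesTo {n : ℕ} {E E' : EdgeVector n} {v : BipVertex n}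
    {I : Finset (BipVertex n)} (h : ∀ e ∉ edgesTo v I, E e = E' e) {x y : BipVertex n}
    (hx : x ≠ v) (hy : y ≠ v) : (bipGraph E).Adj x y ↔ (bipGraph E').Adj x y := by
  rcases x with a | a <;> rcases y with c | c
  · simp [bipGraph]
  · have : (a, c) ∉ edgesTo v I := by
      rcases v with i | i <;> simp_all [edgesTo, eq_comm]
    simp [bipGraph, h _ this]
  · have : (c, a) ∉ edgesTo v I := by
      rcases v with i | i <;> simp_all [edgesTo, eq_comm]
    simp [bipGraph, h _ this]
  · simp [bipGraph]

/-! ### Functions of the transcript -/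

namespace OnlineAlgorithm

variable {Ω : Type*} [MeasurableSpace Ω] {n : ℕ}

/-- The set constructed so far, as a function of the transcript. -/
def outOf (A : OnlineAlgorithm Ω n) (ω : Ω) : Transcript n → Finset (BipVertex n)
  | [] => ∅
  | x :: h => if A.accept ω (x :: h) = true then insert x.1 (A.outOf ω h) else A.outOf ω h

/-- The number of rounds in which the selected vertex had at least `r` potential edges to the set
constructed so far and none of them was present. -/
def freeCount (A : OnlineAlgorithm Ω n) (ω : Ω) (r : ℕ) : Transcript n → ℕ
  | [] => 0
  | x :: h => A.freeCount ω r h +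
      if r ≤ (edgesTo x.1 (A.outOf ω h)).card ∧ Disjoint x.2 (A.outOf ω h) then 1 else 0

theorem outOf_subset_seen (A : OnlineAlgorithm Ω n) (ω : Ω) (h : Transcript n) :
    A.outOf ω h ⊆ h.seen := by
  induction h with
  | nil => simp [outOf]
  | cons x h ih =>
    have hs : Transcript.seen (x :: h) = insert x.1 (Transcript.seen h) := by simp [Transcript.seen]
    rw [outOf, hs]
    split_ifs
    · exact Finset.insert_subset_insert _ ih
    · exact ih.trans (Finset.subset_insert _ _)

theorem partialOutput_eq_outOf (A : OnlineAlgorithm Ω n) (G : SimpleGraph (BipVertex n)) (ω : Ω)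
    (t : ℕ) : A.partialOutput G ω t = A.outOf ω (A.transcript G ω t) := by
  induction t with
  | zero => rfl
  | succ t ih => simp only [partialOutput, outOf, transcript, ih]

theorem length_transcript (A : OnlineAlgorithm Ω n) (G : SimpleGraph (BipVertex n)) (ω : Ω)
    (t : ℕ) : (A.transcript G ω t).length = t := by
  induction t with
  | zero => rfl
  | succ t ih => simp [transcript, ih]

theorem seen_ne_univ (h : Transcript n) (hl : h.length < 2 * n) : h.seen ≠ Finset.univ := by
  intro hu
  have h1 := (List.toFinset_card_le (h.map Prod.fst))
  rw [← Transcript.seen, hu] at h1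
  simp at h1
  omega

theorem disjoint_filter_adj_iff (A : OnlineAlgorithm Ω n) (E : EdgeVector n) (ω : Ω)
    (h : Transcript n) (v : BipVertex n) [DecidablePred ((bipGraph E).Adj v)] :
    Disjoint (h.seen.filter fun u => (bipGraph E).Adj v u) (A.outOf ω h) ↔
      ∀ e ∈ edgesTo v (A.outOf ω h), E e = false := by
  rw [forall_edgesTo_eq_false_iff, Finset.disjoint_right]
  refine forall₂_congr fun u hu => ?_
  simp [A.outOf_subset_seen ω h hu]

/-- Both sides of an independent output cannot exceed `r` by more than the number of rounds
counted by `freeCount`. -/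
theorem min_card_le (A : OnlineAlgorithm Ω n) (E : EdgeVector n) (ω : Ω) (r t : ℕ)
    (ht : t ≤ 2 * n)
    (hI : (bipGraph E).IsIndepSet (A.outOf ω (A.transcript (bipGraph E) ω t) : Set _)) :
    min (A.outOf ω (A.transcript (bipGraph E) ω t)).toLeft.card
      (A.outOf ω (A.transcript (bipGraph E) ω t)).toRight.card ≤
      r + A.freeCount ω r (A.transcript (bipGraph E) ω t) := by
  classical
  induction t with
  | zero => simp [transcript, outOf, Finset.toLeft]
  | succ t ih =>
    set h := A.transcript (bipGraph E) ω t with hh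
    set v := A.next ω h with hv
    have hnot : v ∉ h.seen := A.next_notMem ω h
      (seen_ne_univ h (by rw [hh, length_transcript]; omega))
    have hvI : v ∉ A.outOf ω h := fun hm => hnot (A.outOf_subset_seen ω h hm)
    simp only [transcript, outOf, freeCount, ← hh, ← hv, disjoint_filter_adj_iff] at hI ⊢
    split_ifs at hI with hacc
    · have hsub : (bipGraph E).IsIndepSet (A.outOf ω h : Set _) :=
        hI.mono (by simp)
      specialize ih (by omega) hsub
      have hfree : ∀ e ∈ edgesTo v (A.outOf ω h), E e = false := by
        rw [forall_edgesTo_eq_false_iff]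
        intro u hu
        exact hI (by simp) (by simp [hu]) (by rintro rfl; exact hvI hu)
      rw [if_pos hacc]
      rw [min_le_iff] at ih ⊢
      -- Either the round is counted, which pays for the one vertex added, or the side opposite `v`
      -- has fewer than `r` vertices and alone bounds the minimum.
      have hfc : A.freeCount ω r h + 1 = A.freeCount ω r h + (if r ≤
          (edgesTo v (A.outOf ω h)).card ∧ ∀ e ∈ edgesTo v (A.outOf ω h), E e = false then 1 else 0)
          ∨ (edgesTo v (A.outOf ω h)).card < r := by
        by_cases hr : r ≤ (edgesTo v (A.outOf ω h)).card
        · exact Or.inl (by rw [if_pos ⟨hr, hfree⟩])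
        · exact Or.inr (by omega)
      generalize A.outOf ω h = I at *
      rcases v with i | j
      · rw [card_edgesTo_inl] at hfc
        rw [card_edgesTo_inl]
        have h1 : (insert (Sum.inl i) I : Finset (BipVertex n)).toLeft.card ≤ I.toLeft.card + 1 := by
          simpa using Finset.card_insert_le i I.toLeft
        have h2 : (insert (Sum.inl i) I : Finset (BipVertex n)).toRight = I.toRight := by simp
        rw [h2]
        omega
      · rw [card_edgesTo_inr] at hfc
        rw [card_edgesTo_inr]
        have h1 : (insert (Sum.inr j) I : Finset (BipVertex n)).toRight.card ≤
            I.toRight.card + 1 := by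
          simpa using Finset.card_insert_le j I.toRight
        have h2 : (insert (Sum.inr j) I : Finset (BipVertex n)).toLeft = I.toLeft := by simp
        rw [h2]
        omega
    · simp only [hacc]
      have := ih (by omega) (by simpa using hI)
      simp only [Bool.false_eq_true, if_false]
      omega

/-- The transcript depends only on the edges among the vertices seen. -/
theorem transcript_congr (A : OnlineAlgorithm Ω n) (G G' : SimpleGraph (BipVertex n)) (ω : Ω)
    (t : ℕ)
    (hG : ∀ x ∈ (A.transcript G ω t).seen, ∀ y ∈ (A.transcript G ω t).seen,
      (G.Adj x y ↔ G'.Adj x y)) :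
    A.transcript G' ω t = A.transcript G ω t := by
  classical
  induction t with
  | zero => rfl
  | succ t ih =>
    have hs : (A.transcript G ω (t + 1)).seen =
        insert (A.next ω (A.transcript G ω t)) (A.transcript G ω t).seen := by
      simp [Transcript.seen, transcript]
    rw [hs] at hG
    have ih' := ih fun x hx y hy => hG x (Finset.mem_insert_of_mem hx) y
      (Finset.mem_insert_of_mem hy)
    simp only [transcript]
    rw [ih']
    congr 2
    exact Finset.filter_congr fun u hu => (hG _ (Finset.mem_insert_self _ _) u
      (Finset.mem_insert_of_mem hu)).symm

/-! ### The exponential moment of `freeCount` -/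

/-- Conditionally on a transcript, the next vertex has no edge to the current set with probability
at most `(1 - p) ^ r`, if there are at least `r` potential edges. -/
theorem bipRandom_transcript_inter_le (A : OnlineAlgorithm Ω n) (p : unitInterval) (ω : Ω)
    (r t : ℕ) (ht : t < 2 * n) (h : Transcript n) :
    bipRandom n p ({E | A.transcript (bipGraph E) ω t = h} ∩
      {E | r ≤ (edgesTo (A.next ω h) (A.outOf ω h)).card ∧
        ∀ e ∈ edgesTo (A.next ω h) (A.outOf ω h), E e = false}) ≤
      ENNReal.ofReal (1 - p) ^ r * bipRandom n p {E | A.transcript (bipGraph E) ω t = h} := by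
  by_cases hne : {E : EdgeVector n | A.transcript (bipGraph E) ω t = h} = ∅
  · simp [hne]
  obtain ⟨E₀, hE₀⟩ := Set.nonempty_iff_ne_empty.2 hne
  have hlen : h.length = t := by rw [← hE₀, length_transcript]
  have hv : A.next ω h ∉ h.seen := A.next_notMem ω h (seen_ne_univ h (by omega))
  by_cases hr : r ≤ (edgesTo (A.next ω h) (A.outOf ω h)).card
  · simp only [hr, true_and]
    rw [bipRandom_inter_forall_false]
    · refine mul_le_mul' (pow_le_pow_right_of_le_one' ?_ hr) le_rfl
      exact ENNReal.ofReal_le_one.2 (by linarith [p.2.1])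
    -- The transcript only involves pairs of seen vertices, and `v` is unseen.
    · intro E E' hEE' hE
      refine (A.transcript_congr _ _ ω t fun x hx y hy => ?_).trans hE
      change _ = _ at hE
      rw [hE] at hx hy
      exact adj_iff_of_eqOn_compl_edgesTo hEE' (fun h => hv (h ▸ hx)) (fun h => hv (h ▸ hy))
  · simp [hr]

open scoped ENNReal

/-- One step of the moment recursion, by conditioning on the transcript. Counting a round regardless
of acceptance makes the increment depend only on the past and on fresh edges. -/
theorem lintegral_pow_freeCount_succ_le (A : OnlineAlgorithm Ω n) (p : unitInterval) (ω : Ω)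
    (r t : ℕ) (ht : t < 2 * n) (x : ℝ≥0∞) :
    ∫⁻ E, x ^ A.freeCount ω r (A.transcript (bipGraph E) ω (t + 1)) ∂bipRandom n p ≤
      (1 + x * ENNReal.ofReal (1 - p) ^ r) *
        ∫⁻ E, x ^ A.freeCount ω r (A.transcript (bipGraph E) ω t) ∂bipRandom n p := by
  classical
  set ν := bipRandom n p
  set T : EdgeVector n → Transcript n := fun E => A.transcript (bipGraph E) ω t with hT
  set B : Transcript n → Set (EdgeVector n) := fun h =>
    {E | r ≤ (edgesTo (A.next ω h) (A.outOf ω h)).card ∧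
        ∀ e ∈ edgesTo (A.next ω h) (A.outOf ω h), E e = false} with hB
  have hmeas : ∀ f : EdgeVector n → ℝ≥0∞, Measurable f := fun f => measurable_of_finite f
  have hms : ∀ s : Set (EdgeVector n), MeasurableSet s := fun s => (Set.toFinite s).measurableSet
  -- The sharp factor `x - 1` is relaxed to `x`, which avoids subtraction in `ℝ≥0∞`.
  have hstep : ∀ E, x ^ A.freeCount ω r (A.transcript (bipGraph E) ω (t + 1)) ≤
      x ^ A.freeCount ω r (T E) +
        x * (x ^ A.freeCount ω r (T E) * (B (T E)).indicator 1 E) := by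
    intro E
    simp only [transcript, freeCount, disjoint_filter_adj_iff]
    split_ifs with hE
    · rw [Set.indicator_of_mem (show E ∈ B (T E) from hE), pow_succ]
      simp only [Pi.one_apply, mul_one]
      rw [mul_comm]
      exact le_add_self
    · rw [Set.indicator_of_notMem (show E ∉ B (T E) from hE)]
      simp [hT]
  -- On each fibre of `T` both the count and the event `B` are fixed.
  have hfib : ∀ (f : EdgeVector n → ℝ≥0∞), ∫⁻ E, f E ∂ν =
      ∑ h ∈ Finset.univ.image T, ∫⁻ E in {E | T E = h}, f E ∂ν := by
    intro f
    rw [← lintegral_biUnion_finset _ (fun _ _ => hms _)]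
    · rw [← setLIntegral_univ]
      congr 2
      ext E
      simp
    · intro a _ b _ hab
      refine Set.disjoint_left.2 fun E h1 h2 => hab ?_
      rw [← h1.out, ← h2.out]
  calc _ ≤ ∫⁻ E, x ^ A.freeCount ω r (T E) +
        x * (x ^ A.freeCount ω r (T E) * (B (T E)).indicator 1 E) ∂ν := lintegral_mono hstep
    _ = ∫⁻ E, x ^ A.freeCount ω r (T E) ∂ν +
        x * ∫⁻ E, x ^ A.freeCount ω r (T E) * (B (T E)).indicator 1 E ∂ν := by
      rw [lintegral_add_left (hmeas _), lintegral_const_mul _ (hmeas _)]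
    _ ≤ ∫⁻ E, x ^ A.freeCount ω r (T E) ∂ν + x * (ENNReal.ofReal (1 - p) ^ r *
          ∫⁻ E, x ^ A.freeCount ω r (T E) ∂ν) := by
      gcongr
      rw [hfib, hfib (fun E => x ^ A.freeCount ω r (T E)), Finset.mul_sum]
      refine Finset.sum_le_sum fun h _ => ?_
      have e1 : ∫⁻ E in {E | T E = h}, x ^ A.freeCount ω r (T E) * (B (T E)).indicator 1 E ∂ν =
          ∫⁻ E in {E | T E = h}, x ^ A.freeCount ω r h * (B h).indicator 1 E ∂ν :=
        setLIntegral_congr_fun (hms _) fun E hE => by rw [hE.out]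
      have e2 : ∫⁻ E in {E | T E = h}, x ^ A.freeCount ω r (T E) ∂ν =
          ∫⁻ E in {E | T E = h}, x ^ A.freeCount ω r h ∂ν :=
        setLIntegral_congr_fun (hms _) fun E hE => by rw [hE.out]
      rw [e1, e2, lintegral_const_mul _ (hmeas _), lintegral_indicator_one (hms _),
        Measure.restrict_apply (hms _), setLIntegral_const, Set.inter_comm, mul_left_comm]
      gcongr
      exact A.bipRandom_transcript_inter_le p ω r t ht h
    _ = _ := by rw [← mul_assoc, add_mul, one_mul]

theorem lintegral_pow_freeCount_le (A : OnlineAlgorithm Ω n) (p : unitInterval) (ω : Ω)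
    (r t : ℕ) (ht : t ≤ 2 * n) (x : ℝ≥0∞) :
    ∫⁻ E, x ^ A.freeCount ω r (A.transcript (bipGraph E) ω t) ∂bipRandom n p ≤
      (1 + x * ENNReal.ofReal (1 - p) ^ r) ^ t := by
  induction t with
  | zero => simp [transcript, freeCount]
  | succ t ih =>
    refine (A.lintegral_pow_freeCount_succ_le p ω r t (by omega) x).trans ?_
    rw [pow_succ']
    gcongr
    exact ih (by omega)

/-! ### Measurability in the seed -/

/-- Transcripts form a countable type, so countable unions over the previous transcript suffice. -/
theorem measurableSet_transcript_eq (A : OnlineAlgorithm Ω n) (G : SimpleGraph (BipVertex n))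
    (t : ℕ) (h : Transcript n) : MeasurableSet {ω | A.transcript G ω t = h} := by
  classical
  induction t generalizing h with
  | zero => exact MeasurableSet.const ([] = h)
  | succ t ih =>
    have : {ω | A.transcript G ω (t + 1) = h} = ⋃ g : Transcript n, ⋃ v : BipVertex n,
        {ω | A.transcript G ω t = g} ∩ ({ω | A.next ω g = v} ∩
          {_ω | (v, g.seen.filter fun u => G.Adj v u) :: g = h}) := by
      ext ω
      simp [transcript]
    rw [this]
    exact MeasurableSet.iUnion fun g => MeasurableSet.iUnion fun v =>
      (ih g).inter ((A.measurableSet_next g v).inter (MeasurableSet.const _))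

theorem measurableSet_outOf_eq (A : OnlineAlgorithm Ω n) (h : Transcript n)
    (I : Finset (BipVertex n)) : MeasurableSet {ω | A.outOf ω h = I} := by
  classical
  induction h generalizing I with
  | nil => exact MeasurableSet.const (∅ = I)
  | cons x h ih =>
    have : {ω | A.outOf ω (x :: h) = I} =
        ({ω | A.accept ω (x :: h) = true} ∩ ⋃ J : Finset (BipVertex n),
          {ω | A.outOf ω h = J} ∩ {_ω | insert x.1 J = I}) ∪
        ({ω | A.accept ω (x :: h) = true}ᶜ ∩ {ω | A.outOf ω h = I}) := by
      ext ω
      by_cases hacc : A.accept ω (x :: h) = true <;> simp [outOf, hacc]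
    rw [this]
    exact ((A.measurableSet_accept _).inter (MeasurableSet.iUnion fun J =>
      (ih J).inter (MeasurableSet.const _))).union ((A.measurableSet_accept _).compl.inter (ih I))

theorem measurableSet_output_eq (A : OnlineAlgorithm Ω n) (G : SimpleGraph (BipVertex n))
    (I : Finset (BipVertex n)) : MeasurableSet {ω | A.output G ω = I} := by
  have : {ω | A.output G ω = I} = ⋃ h : Transcript n,
      {ω | A.transcript G ω (2 * n) = h} ∩ {ω | A.outOf ω h = I} := by
    ext ω
    simp [output, partialOutput_eq_outOf]
  rw [this]
  exact MeasurableSet.iUnion fun h =>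
    (A.measurableSet_transcript_eq G _ h).inter (A.measurableSet_outOf_eq h I)

/-- Needed to disintegrate the success probability over the seed. -/
theorem measurableSet_output_mem (A : OnlineAlgorithm Ω n)
    (P : EdgeVector n → Finset (BipVertex n) → Prop) :
    MeasurableSet {x : Ω × EdgeVector n | P x.2 (A.output (bipGraph x.2) x.1)} := by
  have : {x : Ω × EdgeVector n | P x.2 (A.output (bipGraph x.2) x.1)} =
      ⋃ E : EdgeVector n, ⋃ I : Finset (BipVertex n),
        ({ω | A.output (bipGraph E) ω = I} ×ˢ {E}) ∩ {_x | P E I} := by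
    ext ⟨ω, E⟩
    simp
  rw [this]
  exact MeasurableSet.iUnion fun E => MeasurableSet.iUnion fun I =>
    ((A.measurableSet_output_eq _ I).prod (measurableSet_singleton E)).inter
      (MeasurableSet.const _)

end OnlineAlgorithm

end

/-! ### Tail bound for a fixed seed, and averaging over seeds -/

open scoped ENNReal in
theorem OnlineAlgorithm.mul_bipRandom_le_freeCount_le {Ω : Type*} [MeasurableSpace Ω] {n : ℕ}
    (A : OnlineAlgorithm Ω n) (p : unitInterval) (ω : Ω) (r M : ℕ) {x : ℝ≥0∞} (hx : 1 ≤ x) :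
    x ^ M * bipRandom n p {E | M ≤ A.freeCount ω r (A.transcript (bipGraph E) ω (2 * n))} ≤
      (1 + x * ENNReal.ofReal (1 - p) ^ r) ^ (2 * n) := by
  refine le_trans ?_ (A.lintegral_pow_freeCount_le p ω r (2 * n) le_rfl x)
  refine le_trans ?_ (mul_meas_ge_le_lintegral (measurable_of_finite _) (x ^ M))
  gcongr
  exact fun hE => pow_le_pow_right₀ hx hE

/-- Both sides of a `γ`-balanced set `I` have more than `γ |I| - 1` vertices if `γ ≤ 1 / 2`. -/
theorem IsBalancedIndepSet.lt_card {n : ℕ} {G : SimpleGraph (BipVertex n)} {γ : ℝ}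
    {I : Finset (BipVertex n)} (h : IsBalancedIndepSet G γ I) (hγ : γ ≤ 1 / 2) :
    γ * I.card - 1 < I.toLeft.card ∧ γ * I.card - 1 < I.toRight.card := by
  have hc : (I.toLeft.card : ℝ) + I.toRight.card = I.card := by
    exact_mod_cast I.card_toLeft_add_card_toRight
  have h2 : γ * I.card ≤ 1 / 2 * I.card := by gcongr
  -- The other side has more than `(1 - γ) |I| - 1 ≥ γ |I| - 1` vertices.
  rcases h.2 with h | h <;> rw [abs_lt] at h <;> constructor <;> linarith

/-- For each seed, the probability of finding an independent set with more than `(1 + ε) L - 1`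
vertices on each side, where `b ^ L = n` for `b = exp β = 1 / (1 - p)`. -/
theorem OnlineAlgorithm.bipRandom_success_le {Ω : Type*} [MeasurableSpace Ω] {n : ℕ}
    (A : OnlineAlgorithm Ω n) (p : unitInterval) (ω : Ω) {β ℓ ε : ℝ} (hβ : 0 < β) (hℓ : 0 ≤ ℓ)
    (hε : 0 < ε) (hp : 1 - (p : ℝ) = Real.exp (-β)) (hn : (n : ℝ) = Real.exp (β * ℓ)) :
    bipRandom n p {E | (bipGraph E).IsIndepSet (A.output (bipGraph E) ω : Set (BipVertex n)) ∧
      (1 + ε) * ℓ - 1 < ((A.output (bipGraph E) ω).toLeft.card : ℝ) ∧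
      (1 + ε) * ℓ - 1 < ((A.output (bipGraph E) ω).toRight.card : ℝ)} ≤
      ENNReal.ofReal (Real.exp (2 - β * (ε * ℓ / 2) * (ε * ℓ / 2 - 2))) := by
  -- The excess `εℓ` is split in half: `r` takes one half and `M` the other. The `2` in `M` absorbs
  -- the balance slack and the rounding of `r`. `X` is the largest base for which `n X q ^ r ≤ 1`
  -- follows from `r ≥ (1 + ε/2) ℓ`.
  set r := ⌈(1 + ε / 2) * ℓ⌉₊ with hr
  set M := ⌈ε * ℓ / 2 - 2⌉₊ with hM
  set X := Real.exp (β * (ε * ℓ / 2)) with hX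
  have hX1 : 1 ≤ X := Real.one_le_exp (by positivity)
  have htail := A.mul_bipRandom_le_freeCount_le p ω r M (x := ENNReal.ofReal X)
    (by simpa using hX1)
  have hsub : {E | (bipGraph E).IsIndepSet (A.output (bipGraph E) ω : Set (BipVertex n)) ∧
      (1 + ε) * ℓ - 1 < ((A.output (bipGraph E) ω).toLeft.card : ℝ) ∧
      (1 + ε) * ℓ - 1 < ((A.output (bipGraph E) ω).toRight.card : ℝ)} ⊆
      {E | M ≤ A.freeCount ω r (A.transcript (bipGraph E) ω (2 * n))} := by
    rintro E ⟨hind, hl, hr'⟩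
    rw [output, partialOutput_eq_outOf] at hind hl hr'
    have hmin := A.min_card_le E ω r (2 * n) le_rfl hind
    have hrlt : (r : ℝ) < (1 + ε / 2) * ℓ + 1 := Nat.ceil_lt_add_one (by positivity)
    refine Nat.ceil_le.2 ?_
    rcases min_le_iff.1 hmin with h | h
    all_goals
      have h' := (Nat.cast_le (α := ℝ)).2 h
      push_cast at h'
      linarith
  have hbound : (1 + ENNReal.ofReal X * ENNReal.ofReal (1 - p) ^ r) ^ (2 * n) ≤
      ENNReal.ofReal (Real.exp 2) := by
    have hq : 0 ≤ 1 - (p : ℝ) := by rw [hp]; positivity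
    rw [← ENNReal.ofReal_pow hq, ← ENNReal.ofReal_mul (by positivity), ← ENNReal.ofReal_one,
      ← ENNReal.ofReal_add zero_le_one (by positivity), ← ENNReal.ofReal_pow (by positivity)]
    refine ENNReal.ofReal_le_ofReal ?_
    have hnq : (n : ℝ) * (X * (1 - (p : ℝ)) ^ r) ≤ 1 := by
      rw [hn, hX, hp, ← Real.exp_nat_mul, ← Real.exp_add, ← Real.exp_add, Real.exp_le_one_iff]
      have := mul_le_mul_of_nonneg_left (Nat.le_ceil ((1 + ε / 2) * ℓ)) hβ.le
      rw [← hr] at this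
      linarith
    calc (1 + X * (1 - (p : ℝ)) ^ r) ^ (2 * n)
        ≤ Real.exp (X * (1 - (p : ℝ)) ^ r) ^ (2 * n) := by
          gcongr
          rw [add_comm]
          exact Real.add_one_le_exp _
      _ = Real.exp (2 * (n * (X * (1 - (p : ℝ)) ^ r))) := by
          rw [← Real.exp_nat_mul]; push_cast; ring_nf
      _ ≤ Real.exp 2 := Real.exp_le_exp.2 (by linarith)
  have hXM : Real.exp (β * (ε * ℓ / 2) * (ε * ℓ / 2 - 2)) ≤ X ^ M := by
    rw [hX, ← Real.exp_nat_mul, Real.exp_le_exp, mul_comm]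
    exact mul_le_mul_of_nonneg_right (Nat.le_ceil _) (by positivity)
  have hfinal : ENNReal.ofReal (X ^ M) * bipRandom n p
      {E | M ≤ A.freeCount ω r (A.transcript (bipGraph E) ω (2 * n))} ≤
      ENNReal.ofReal (Real.exp 2) := by
    rw [ENNReal.ofReal_pow (by positivity)]
    exact htail.trans hbound
  refine (measure_mono hsub).trans ?_
  rw [Real.exp_sub, ENNReal.ofReal_div_of_pos (Real.exp_pos _), ENNReal.le_div_iff_mul_le
    (Or.inl (by simp [Real.exp_pos])) (Or.inl ENNReal.ofReal_ne_top), mul_comm]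
  exact le_trans (by gcongr) hfinal

theorem theorem4p4 (p : unitInterval) (hp0 : 0 < (p : ℝ)) (hp1 : (p : ℝ) < 1) :
    ∃ c : ℝ, 0 < c ∧
      ∀ γ : ℝ, 0 < γ → γ ≤ 1 / 2 → ∀ ε : ℝ, 0 < ε →
        ∃ N : ℕ, ∀ n : ℕ, N ≤ n →
          ∀ (Ω : Type*) [MeasurableSpace Ω] (μ : Measure Ω) [IsProbabilityMeasure μ]
            (A : OnlineAlgorithm Ω n),
            ¬ A.Optimizes μ p γ ((1 + ε) * alphaComp p γ n)
                (Real.exp (-(c * ε ^ 2 * Real.logb (logBase p) n ^ 2))) := by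
  set β := Real.log (logBase p) with hβdef
  have hq : 0 < 1 - (p : ℝ) := by linarith
  have hb : 1 < logBase p := by
    rw [logBase, lt_div_iff₀ hq]; linarith
  have hβ : 0 < β := Real.log_pos hb
  have hp : 1 - (p : ℝ) = Real.exp (-β) := by
    rw [Real.exp_neg, hβdef, Real.exp_log (by linarith), logBase, one_div, inv_inv]
  -- Half of the leading coefficient `β / 4` in the tail exponent; the other half beats the
  -- lower-order terms.
  refine ⟨β / 8, by positivity, fun γ hγ0 hγ ε hε => ?_⟩
  have hlim : Filter.Tendsto (fun n : ℕ => Real.logb (logBase p) n) Filter.atTop Filter.atTop :=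
    (Real.tendsto_logb_atTop hb).comp tendsto_natCast_atTop_atTop
  -- With `y = εℓ`, the goal is `βy²/8 - βy > 2`. From `y ≥ 16` the left side is at least `βy`, and
  -- `y ≥ 17 + 2/β` makes that exceed `2`.
  obtain ⟨N, hN⟩ := Filter.eventually_atTop.1
    ((hlim.eventually_ge_atTop ((17 + 2 / β) / ε)).and (Filter.eventually_ge_atTop 1))
  refine ⟨N, fun n hn Ω _ μ _ A hA => ?_⟩
  obtain ⟨hL, hn1⟩ := hN n hn
  set ℓ := Real.logb (logBase p) n with hℓ
  have hℓ0 : 0 ≤ ℓ := le_trans (by positivity) hL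
  have hnexp : (n : ℝ) = Real.exp (β * ℓ) := by
    have hn0 : (0 : ℝ) < n := by exact_mod_cast hn1
    rw [hℓ, Real.logb, mul_div_cancel₀ _ hβ.ne', Real.exp_log hn0]
  have hcomp : γ * ((1 + ε) * alphaComp p γ n) = (1 + ε) * ℓ := by
    have : 1 - γ ≠ 0 := by linarith
    rw [alphaComp, alphaStat, ← hℓ]
    field_simp
  have hmeas := A.measurableSet_output_mem fun E I => IsBalancedIndepSet (bipGraph E) γ I ∧
    (1 + ε) * alphaComp p γ n ≤ (I.card : ℝ)
  rw [OnlineAlgorithm.Optimizes, Measure.prod_apply hmeas] at hA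
  -- The bound is the same for every seed, so `μ` plays no role beyond its total mass.
  have hle := hA.trans (lintegral_mono fun ω => (measure_mono ?_).trans
    (A.bipRandom_success_le p ω hβ hℓ0 hε hp hnexp))
  · rw [lintegral_const, measure_univ, mul_one,
      ENNReal.ofReal_le_ofReal_iff (Real.exp_pos _).le, Real.exp_le_exp] at hle
    have hy : 17 + 2 / β ≤ ε * ℓ := by
      rw [div_le_iff₀ hε] at hL
      linarith
    have h2 : 0 < 2 / β := by positivity
    have h3 : 17 * β + 2 ≤ β * (ε * ℓ) := by
      have := mul_le_mul_of_nonneg_left hy hβ.le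
      rwa [mul_add, mul_div_cancel₀ _ hβ.ne', mul_comm] at this
    have h4 : 0 ≤ β * (ε * ℓ) * (ε * ℓ / 8 - 2) :=
      mul_nonneg (by positivity) (by linarith)
    nlinarith
  · rintro E ⟨hbal, hcard⟩
    have hk : (1 + ε) * ℓ ≤ γ * ((A.output (bipGraph E) ω).card : ℝ) := by
      rw [← hcomp]
      exact mul_le_mul_of_nonneg_left hcard hγ0.le
    obtain ⟨hl, hr⟩ := hbal.lt_card hγ
    exact ⟨hbal.1, by linarith, by linarith⟩
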